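/- For integers $n\ge 1$ and $d\ge 0$ let $$\mathcal A_{n,d}=\{A\in\{0,1\}^{n\times n} : A\mathbf 1=A^{\mathsf T}\mathbf 1=d\mathbf 1\}$$ be the set of adjacency matrices of $d$-regular digraphs on $n$ labelled vertices (self-loops allowed), where $\mathbf 1$ is the all-ones vector. There is an absolute constant $C>0$ such that for every $\varepsilon>0$ there is an $N=N(\varepsilon)$ with the following property. Let $\alpha\in(0,1/2)$, let $n\ge N$ and $d$ be integers with $$(\log n)^{\frac1{1-2\alpha}+\varepsilon}\le d\le \frac n2,$$ and let $B$ be a random $n\times n$ matrix with entries in $\{0,1\}$ that are independent and Bernoulli$(p)$ distributed, where $p=d/n$. Then $$\mathbb P(B\in\mathcal A_{n,d})\ \ge\ \exp\Big(-C\,n\log n\cdot\max\big\{\sqrt{d\log n},\ d^{2/3},\ d^{1-\alpha}\big\}\Big).$$ -/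

import Mathlib

open MeasureTheory ProbabilityTheory
open scoped Matrix

/-- The set `𝒜_{n,d} = {A ∈ {0,1}^{n×n} : A 𝟏 = Aᵀ 𝟏 = d 𝟏}` of adjacency matrices of `d`-regular
digraphs on `n` labelled vertices, self-loops being allowed. -/
def regularDigraphMatrices (n d : ℕ) : Set (Matrix (Fin n) (Fin n) ℝ) :=
  {A | (∀ i j, A i j = 0 ∨ A i j = 1) ∧
    A *ᵥ (fun _ => 1) = (fun _ => (d : ℝ)) ∧
    Aᵀ *ᵥ (fun _ => 1) = (fun _ => (d : ℝ))}

/-- The random matrix `B` has entries in `{0,1}` that are independent and Bernoulli(`p`)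
distributed under `P`. -/
structure IsIIDBernoulliMatrix {Ω : Type*} [MeasurableSpace Ω] (P : Measure Ω) {n : ℕ}
    (B : Ω → Matrix (Fin n) (Fin n) ℝ) (p : ℝ) : Prop where
  measurable_entry : ∀ i j, Measurable (fun ω => B ω i j)
  entry_eq : ∀ ω i j, B ω i j = 0 ∨ B ω i j = 1
  prob_entry_eq_one : ∀ i j, P.real {ω | B ω i j = 1} = p
  indep : iIndepFun (fun (ij : Fin n × Fin n) (ω : Ω) => B ω ij.1 ij.2) P

/-! A typical `B` is within Hamming distance `M = O(n √d)` of a `d`-regular matrix, and each unit of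
distance costs only a factor polynomial in `n`. Each degree of `B` has mean `d` and variance at most
`d`, so with probability at least 1/2 the total degree deviation is at most `3 n √d`
(`half_le_prob_degreeDeviation_le`). Deterministically, deleting surplus edges and then adding edges
by switchings reaches a regular graph after changing at most 7 times that deviation
(`exists_isBiregular_card_symmDiff_le`). Flipping one entry changes the weight of a matrix by a
factor at most `n`, and there are `n ^ 2` entries, so thickening a family by one Hamming step
multiplies its probability by at most `1 + n ^ 3` (`sum_bernoulliWeight_hammingThickening_le`).
Hence the regular matrices have probability at least `(1 + n ^ 3) ^ (-M) / 2 = exp (-O(n √d log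
n))`, and `√d` is at most the maximum in the claim. -/

section Combinatorics

/-! ### Repairing a bipartite graph to a regular one. -/

variable {β γ : Type*} [DecidableEq β] [DecidableEq γ]

/-- The number of elements of `E` that `f` sends to `i`. -/
def fiberCard (f : β → γ) (E : Finset β) (i : γ) : ℕ := (E.filter fun e => f e = i).card

theorem fiberCard_insert (f : β → γ) {E : Finset β} {e : β} (he : e ∉ E) (i : γ) :
    fiberCard f (insert e E) i = fiberCard f E i + if f e = i then 1 else 0 := by
  unfold fiberCard
  rw [Finset.filter_insert]
  split_ifs with h
  · rw [Finset.card_insert_of_notMem (by simp [he])]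
  · rfl

theorem fiberCard_erase_add (f : β → γ) {E : Finset β} {e : β} (he : e ∈ E) (i : γ) :
    fiberCard f (E.erase e) i + (if f e = i then 1 else 0) = fiberCard f E i := by
  rw [← fiberCard_insert f (Finset.notMem_erase e E) i, Finset.insert_erase he]

omit [DecidableEq β] in
theorem sum_fiberCard [Fintype γ] (f : β → γ) (E : Finset β) :
    ∑ i, fiberCard f E i = E.card :=
  (Finset.card_eq_sum_card_fiberwise (fun _ _ => Finset.mem_coe.2 (Finset.mem_univ _))).symm

omit [DecidableEq β] in
theorem card_filter_eq_sum_fiberCard [Fintype γ] (f : β → γ) (E : Finset β) (q : γ → Prop)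
    [DecidablePred q] :
    (E.filter fun e => q (f e)).card = ∑ i with q i, fiberCard f E i := by
  rw [Finset.card_eq_sum_card_fiberwise (f := f) (t := Finset.univ.filter q)]
  · refine Finset.sum_congr rfl fun i hi => ?_
    unfold fiberCard
    congr 1
    ext e
    simp only [Finset.mem_filter, Finset.mem_univ, true_and] at hi ⊢
    constructor
    · rintro ⟨⟨h1, _⟩, h3⟩; exact ⟨h1, h3⟩
    · rintro ⟨h1, h3⟩; exact ⟨⟨h1, h3 ▸ hi⟩, h3⟩
  · intro e he
    simp only [Finset.coe_filter, Set.mem_ofPred_eq] at he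
    simpa using he.2

/-- Excess of the fibres over `d`. -/
def fiberExcess [Fintype γ] (f : β → γ) (d : ℕ) (E : Finset β) : ℕ := ∑ i, (fiberCard f E i - d)

theorem fiberExcess_erase_le [Fintype γ] (f : β → γ) (d : ℕ) {E : Finset β} {e : β}
    (he : e ∈ E) : fiberExcess f d (E.erase e) ≤ fiberExcess f d E :=
  Finset.sum_le_sum fun i _ => by
    have := fiberCard_erase_add f he i
    omega

theorem exists_fiberExcess_erase_lt [Fintype γ] (f : β → γ) {d : ℕ} {E : Finset β} {i : γ}
    (hi : d < fiberCard f E i) :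
    ∃ e ∈ E, fiberExcess f d (E.erase e) < fiberExcess f d E := by
  have hpos : 0 < fiberCard f E i := by omega
  obtain ⟨e, he⟩ := Finset.card_pos.1 hpos
  rw [Finset.mem_filter] at he
  refine ⟨e, he.1, Finset.sum_lt_sum (fun k _ => ?_) ⟨i, Finset.mem_univ _, ?_⟩⟩
  · have := fiberCard_erase_add f he.1 k
    omega
  · have := fiberCard_erase_add f he.1 i
    rw [if_pos he.2] at this
    omega

variable {ι κ : Type*} [Fintype ι] [Fintype κ] [DecidableEq ι] [DecidableEq κ]

/-- Deleting an edge from an overfull fibre lowers the total excess by at least one, so the initial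
excess bounds the number of deletions. -/
theorem exists_subset_fiberCard_le (f : β → ι) (g : β → κ) (d : ℕ) (E : Finset β) :
    ∃ E' ⊆ E, (∀ i, fiberCard f E' i ≤ d) ∧ (∀ j, fiberCard g E' j ≤ d) ∧
      E.card ≤ E'.card + (fiberExcess f d E + fiberExcess g d E) := by
  induction E using Finset.strongInduction with
  | H E ih =>
    have step : ∀ e ∈ E, fiberExcess f d (E.erase e) + fiberExcess g d (E.erase e) <
        fiberExcess f d E + fiberExcess g d E →
        ∃ E' ⊆ E, (∀ i, fiberCard f E' i ≤ d) ∧ (∀ j, fiberCard g E' j ≤ d) ∧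
          E.card ≤ E'.card + (fiberExcess f d E + fiberExcess g d E) := by
      intro e he hlt
      obtain ⟨E', hsub, h1, h2, h3⟩ := ih _ (Finset.erase_ssubset he)
      refine ⟨E', hsub.trans (Finset.erase_subset _ _), h1, h2, ?_⟩
      have := Finset.card_erase_add_one he
      omega
    by_cases hf : ∀ i, fiberCard f E i ≤ d
    · by_cases hg : ∀ j, fiberCard g E j ≤ d
      · exact ⟨E, subset_rfl, hf, hg, Nat.le_add_right _ _⟩
      · push Not at hg
        obtain ⟨j, hj⟩ := hg
        obtain ⟨e, he, hlt⟩ := exists_fiberExcess_erase_lt g hj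
        exact step e he (add_lt_add_of_le_of_lt (fiberExcess_erase_le f d he) hlt)
    · push Not at hf
      obtain ⟨i, hi⟩ := hf
      obtain ⟨e, he, hlt⟩ := exists_fiberExcess_erase_lt f hi
      exact step e he (add_lt_add_of_lt_of_le hlt (fiberExcess_erase_le g d he))

omit [DecidableEq β] in
theorem exists_fiberCard_lt [Fintype γ] (f : β → γ) {d : ℕ} {E : Finset β}
    (h : E.card < Fintype.card γ * d) : ∃ i, fiberCard f E i < d := by
  by_contra! hcon
  have : ∑ _i : γ, d ≤ ∑ i, fiberCard f E i := Finset.sum_le_sum fun i _ => hcon i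
  rw [sum_fiberCard, Finset.sum_const, Finset.card_univ, smul_eq_mul] at this
  omega

theorem card_symmDiff_insert_le (E : Finset β) (e : β) :
    (symmDiff E (insert e E)).card ≤ 1 := by
  refine (Finset.card_le_card (t := {e}) ?_).trans (by simp)
  intro x
  simp only [Finset.mem_symmDiff, Finset.mem_insert, Finset.mem_singleton]
  tauto

theorem card_symmDiff_le_add (A B C : Finset β) :
    (symmDiff A C).card ≤ (symmDiff A B).card + (symmDiff B C).card :=
  (Finset.card_le_card (symmDiff_triangle A B C)).trans (Finset.card_union_le _ _)

/-- A switching argument: a bipartite graph with all degrees at most `d ≤ n / 2` that is not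
`d`-regular can be enlarged by one edge, changing at most three edges, keeping all degrees at
most `d`. -/
theorem exists_card_succ_of_card_lt {n d : ℕ} (hd : 2 * d ≤ n) {E : Finset (Fin n × Fin n)}
    (hr : ∀ i, fiberCard Prod.fst E i ≤ d) (hc : ∀ j, fiberCard Prod.snd E j ≤ d)
    (hE : E.card < n * d) :
    ∃ E' : Finset (Fin n × Fin n), (∀ i, fiberCard Prod.fst E' i ≤ d) ∧
      (∀ j, fiberCard Prod.snd E' j ≤ d) ∧ E'.card = E.card + 1 ∧
      (symmDiff E E').card ≤ 3 := by
  obtain ⟨i, hi⟩ := exists_fiberCard_lt (Prod.fst : Fin n × Fin n → Fin n) (d := d) (E := E)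
    (by simpa using hE)
  obtain ⟨j, hj⟩ := exists_fiberCard_lt (Prod.snd : Fin n × Fin n → Fin n) (d := d) (E := E)
    (by simpa using hE)
  by_cases hA : ∃ k, fiberCard Prod.fst E k < d ∧ (k, j) ∉ E
  · obtain ⟨k, hk, hkj⟩ := hA
    refine ⟨insert (k, j) E, fun a => ?_, fun b => ?_, Finset.card_insert_of_notMem hkj,
      (card_symmDiff_insert_le _ _).trans (by norm_num)⟩
    · rw [fiberCard_insert _ hkj]
      have := hr a
      split_ifs with h
      · simp only at h; subst h; omega
      · omega
    · rw [fiberCard_insert _ hkj]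
      have := hc b
      split_ifs with h
      · simp only at h; subst h; omega
      · omega
  push Not at hA
  have hij := hA i hi
  have key : ∃ k l, (k, l) ∈ E ∧ (k, j) ∉ E ∧ (i, l) ∉ E := by
    -- Every row missing column `j` is full by `hA`. If no switch exists, the edges in these rows
    -- all end in neighbours of `i`, so `(n - deg j) * d ≤ deg i * d`. This contradicts `deg i, deg
    -- j < d` and `2 * d ≤ n`.
    by_contra! hcon
    have hsub : (E.filter fun e => (e.1, j) ∉ E) ⊆ E.filter fun e => (i, e.2) ∈ E := by
      intro e he
      rw [Finset.mem_filter] at he ⊢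
      exact ⟨he.1, hcon e.1 e.2 he.1 he.2⟩
    have hle := Finset.card_le_card hsub
    rw [card_filter_eq_sum_fiberCard Prod.fst E (fun k => (k, j) ∉ E),
      card_filter_eq_sum_fiberCard Prod.snd E (fun l => (i, l) ∈ E)] at hle
    have h1 : ∑ k with (k, j) ∉ E, fiberCard Prod.fst E k =
        (Finset.univ.filter fun k => (k, j) ∉ E).card * d := by
      rw [Finset.sum_const_nat]
      intro k hk
      rw [Finset.mem_filter] at hk
      have := hr k
      by_contra hne
      exact hk.2 (hA k (by omega))
    have h2 : ∑ l with (i, l) ∈ E, fiberCard Prod.snd E l ≤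
        (Finset.univ.filter fun l => (i, l) ∈ E).card * d :=
      (Finset.sum_le_sum fun l _ => hc l).trans (by simp)
    have h3 : (Finset.univ.filter fun l => (i, l) ∈ E).card = fiberCard Prod.fst E i := by
      refine Finset.card_bij (fun l _ => (i, l)) ?_ ?_ ?_
      · intro l hl; simpa using hl
      · intro a _ b _ h; simpa using h
      · rintro ⟨a, b⟩ hab
        simp only [Finset.mem_filter] at hab
        obtain ⟨h, rfl⟩ := hab
        exact ⟨b, by simpa using h, rfl⟩
    have h4 : (Finset.univ.filter fun k => (k, j) ∈ E).card = fiberCard Prod.snd E j := by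
      refine Finset.card_bij (fun k _ => (k, j)) ?_ ?_ ?_
      · intro l hl; simpa using hl
      · intro a _ b _ h; simpa using h
      · rintro ⟨a, b⟩ hab
        simp only [Finset.mem_filter] at hab
        obtain ⟨h, rfl⟩ := hab
        exact ⟨a, by simpa using h, rfl⟩
    have h5 := Finset.card_filter_add_card_filter_not (s := (Finset.univ : Finset (Fin n)))
      (fun k => (k, j) ∈ E)
    rw [Finset.card_univ, Fintype.card_fin] at h5
    rw [h1] at hle
    have h6 := Nat.le_of_mul_le_mul_right (hle.trans h2) (by omega)
    omega
  obtain ⟨k, l, hkl, hkj, hil⟩ := key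
  have hki : k ≠ i := by rintro rfl; exact hkj hij
  have hn1 : (k, j) ∉ E.erase (k, l) := fun h => hkj (Finset.mem_of_mem_erase h)
  have hn2 : (i, l) ∉ insert (k, j) (E.erase (k, l)) := by
    simp only [Finset.mem_insert, Finset.mem_erase, Prod.mk.injEq, not_or]
    exact ⟨fun h => hki h.1.symm, fun h => hil h.2⟩
  -- Trading `(k, l)` for `(k, j)` and `(i, l)` preserves the degrees of row `k` and column `l`, and
  -- raises only the deficient row `i` and column `j`.
  refine ⟨insert (i, l) (insert (k, j) (E.erase (k, l))), fun a => ?_, fun b => ?_, ?_, ?_⟩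
  · rw [fiberCard_insert _ hn2, fiberCard_insert _ hn1]
    have h1 := fiberCard_erase_add Prod.fst hkl a
    have h2 := hr a
    simp only at h1 ⊢
    by_cases hia : i = a
    · subst hia
      rw [if_neg hki] at h1 ⊢
      rw [if_pos rfl]
      omega
    · rw [if_neg hia]
      omega
  · rw [fiberCard_insert _ hn2, fiberCard_insert _ hn1]
    have h1 := fiberCard_erase_add Prod.snd hkl b
    have h2 := hc b
    simp only at h1 ⊢
    by_cases hjb : j = b
    · subst hjb
      rw [if_pos rfl]
      omega
    · rw [if_neg hjb]
      omega
  · rw [Finset.card_insert_of_notMem hn2, Finset.card_insert_of_notMem hn1,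
      Finset.card_erase_add_one hkl]
  · refine (Finset.card_le_card (t := {(k, l), (k, j), (i, l)}) ?_).trans Finset.card_le_three
    intro x
    simp only [Finset.mem_symmDiff, Finset.mem_insert, Finset.mem_singleton, Finset.mem_erase]
    tauto

/-- All fibres of both coordinate projections have `d` elements. -/
def IsBiregular {n : ℕ} (d : ℕ) (E : Finset (Fin n × Fin n)) : Prop :=
  (∀ i, fiberCard Prod.fst E i = d) ∧ ∀ j, fiberCard Prod.snd E j = d

omit [DecidableEq β] in
theorem fiberCard_eq_of_card_eq [Fintype γ] (f : β → γ) {d : ℕ} {E : Finset β}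
    (hle : ∀ i, fiberCard f E i ≤ d) (hE : E.card = Fintype.card γ * d) (i : γ) :
    fiberCard f E i = d := by
  have h : ∑ i, fiberCard f E i = ∑ _i : γ, d := by
    rw [sum_fiberCard, hE, Finset.sum_const, Finset.card_univ, smul_eq_mul]
  exact (Finset.sum_eq_sum_iff_of_le fun i _ => hle i).1 h i (Finset.mem_univ i)

theorem exists_isBiregular_of_fiberCard_le {n d : ℕ} (hd : 2 * d ≤ n) (D : ℕ)
    (E : Finset (Fin n × Fin n)) (hr : ∀ i, fiberCard Prod.fst E i ≤ d)
    (hc : ∀ j, fiberCard Prod.snd E j ≤ d) (hE : E.card + D = n * d) :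
    ∃ A, IsBiregular d A ∧ (symmDiff E A).card ≤ 3 * D := by
  induction D generalizing E with
  | zero =>
    refine ⟨E, ⟨fiberCard_eq_of_card_eq _ hr ?_, fiberCard_eq_of_card_eq _ hc ?_⟩, by simp⟩ <;>
      simpa using hE
  | succ D ih =>
    obtain ⟨E', hr', hc', hcard, hdist⟩ := exists_card_succ_of_card_lt hd hr hc (by omega)
    obtain ⟨A, hA, hA'⟩ := ih E' hr' hc' (by omega)
    exact ⟨A, hA, (card_symmDiff_le_add E E' A).trans (by omega)⟩

/-- Total deviation of the degrees from `d`. -/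
noncomputable def degreeDeviation {n : ℕ} (d : ℕ) (E : Finset (Fin n × Fin n)) : ℝ :=
  ∑ i, |(fiberCard Prod.fst E i : ℝ) - d| + ∑ j, |(fiberCard Prod.snd E j : ℝ) - d|

omit [DecidableEq β] in
theorem fiberExcess_le_sum_abs [Fintype γ] (f : β → γ) (d : ℕ) (E : Finset β) :
    (fiberExcess f d E : ℝ) ≤ ∑ i, |(fiberCard f E i : ℝ) - d| := by
  unfold fiberExcess
  rw [Nat.cast_sum]
  refine Finset.sum_le_sum fun i _ => ?_
  rcases le_total d (fiberCard f E i) with h | h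
  · rw [Nat.cast_sub h]; exact le_abs_self _
  · rw [Nat.sub_eq_zero_of_le h, Nat.cast_zero]; exact abs_nonneg _

/-- With total deviation `Δ`, at most `Δ` edges are deleted. The deficit is then at most `Δ + Δ`
(original shortfall plus deletions), and each missing edge costs at most 3 changes: `1 + 3 * 2 = 7`.
-/
theorem exists_isBiregular_card_symmDiff_le {n d : ℕ} (hd : 2 * d ≤ n)
    (E : Finset (Fin n × Fin n)) :
    ∃ A, IsBiregular d A ∧ ((symmDiff E A).card : ℝ) ≤ 7 * degreeDeviation d E := by
  obtain ⟨E', hsub, hr, hc, hcard⟩ :=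
    exists_subset_fiberCard_le (Prod.fst : Fin n × Fin n → Fin n) Prod.snd d E
  have hle : E'.card ≤ n * d := by
    rw [← sum_fiberCard Prod.fst E']
    exact (Finset.sum_le_sum fun i _ => hr i).trans (by simp)
  obtain ⟨A, hA, hdist⟩ := exists_isBiregular_of_fiberCard_le hd (n * d - E'.card) E' hr hc
    (by omega)
  refine ⟨A, hA, ?_⟩
  have h1 := card_symmDiff_le_add E E' A
  have h2 : (symmDiff E E').card + E'.card = E.card := by
    have : symmDiff E E' = E \ E' := by
      rw [symmDiff_def, sup_eq_left]
      simp [Finset.sdiff_eq_empty_iff_subset.2 hsub]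
    rw [this, Finset.card_sdiff_add_card_eq_card hsub]
  have h3 : (n * d : ℝ) - E.card ≤ ∑ i, |(fiberCard Prod.fst E i : ℝ) - d| := by
    rw [← sum_fiberCard Prod.fst E]
    have : (n * d : ℝ) - (∑ i, fiberCard Prod.fst E i : ℕ) =
        ∑ i, ((d : ℝ) - fiberCard Prod.fst E i) := by
      simp [Finset.sum_sub_distrib]
    rw [this]
    refine Finset.sum_le_sum fun i _ => ?_
    rw [abs_sub_comm]
    exact le_abs_self _
  have h4 := fiberExcess_le_sum_abs Prod.fst d E
  have h5 := fiberExcess_le_sum_abs Prod.snd d E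
  have h6 : ((n * d - E'.card : ℕ) : ℝ) = n * d - E'.card := by
    rw [Nat.cast_sub hle, Nat.cast_mul]
  have h7 : ((symmDiff E A).card : ℝ) ≤ (symmDiff E E').card + 3 * (n * d - E'.card : ℕ) := by
    exact_mod_cast h1.trans (by omega)
  have h8 : ((symmDiff E E').card : ℝ) + E'.card = E.card := by exact_mod_cast h2
  have h9 : (E.card : ℝ) ≤ E'.card + (fiberExcess Prod.fst d E + fiberExcess Prod.snd d E) := by
    exact_mod_cast hcard
  have h10 : 0 ≤ ∑ j, |(fiberCard Prod.snd E j : ℝ) - d| :=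
    Finset.sum_nonneg fun _ _ => abs_nonneg _
  unfold degreeDeviation
  rw [h6] at h7
  linarith

end Combinatorics

/-! ### Hamming neighbourhoods under the Bernoulli product weight. -/

section Weights

variable {β : Type*} [Fintype β] [DecidableEq β]

/-- The probability that a `p`-random subset equals `E`. -/
noncomputable def bernoulliWeight (p : ℝ) (E : Finset β) : ℝ :=
  ∏ e, if e ∈ E then p else 1 - p

theorem bernoulliWeight_nonneg {p : ℝ} (h0 : 0 ≤ p) (h1 : p ≤ 1) (E : Finset β) :
    0 ≤ bernoulliWeight p E :=
  Finset.prod_nonneg fun e _ => by split_ifs <;> linarith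

/-- Only the factor at `e` changes, swapping `p` and `1 - p`; `K` bounds both ratios. -/
theorem bernoulliWeight_le_symmDiff_singleton {p K : ℝ} (h0 : 0 ≤ p) (h1 : p ≤ 1)
    (hK1 : p ≤ K * (1 - p)) (hK2 : 1 - p ≤ K * p) (E : Finset β) (e : β) :
    bernoulliWeight p E ≤ K * bernoulliWeight p (symmDiff E {e}) := by
  unfold bernoulliWeight
  rw [← Finset.mul_prod_erase Finset.univ _ (Finset.mem_univ e),
    ← Finset.mul_prod_erase Finset.univ (fun x => if x ∈ symmDiff E {e} then p else 1 - p)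
      (Finset.mem_univ e), ← mul_assoc]
  have hrest : ∏ x ∈ Finset.univ.erase e, (if x ∈ symmDiff E {e} then p else 1 - p) =
      ∏ x ∈ Finset.univ.erase e, if x ∈ E then p else 1 - p := by
    refine Finset.prod_congr rfl fun x hx => ?_
    have hxe : x ≠ e := (Finset.mem_erase.1 hx).1
    simp [Finset.mem_symmDiff, hxe]
  rw [hrest]
  refine mul_le_mul_of_nonneg_right ?_
    (Finset.prod_nonneg fun e _ => by split_ifs <;> linarith)
  by_cases he : e ∈ E <;> simp [Finset.mem_symmDiff, he, hK1, hK2]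

/-- The sets at Hamming distance at most `k` from the family `S`. -/
def hammingThickening (k : ℕ) (S : Finset (Finset β)) : Finset (Finset β) :=
  Finset.univ.filter fun E => ∃ A ∈ S, (symmDiff E A).card ≤ k

theorem mem_hammingThickening {k : ℕ} {S : Finset (Finset β)} {E : Finset β} :
    E ∈ hammingThickening k S ↔ ∃ A ∈ S, (symmDiff E A).card ≤ k := by
  simp [hammingThickening]

theorem hammingThickening_zero (S : Finset (Finset β)) : hammingThickening 0 S = S := by
  ext E
  rw [mem_hammingThickening]
  constructor
  · rintro ⟨A, hA, h⟩
    have : E = A := symmDiff_eq_bot.1 (Finset.card_eq_zero.1 (Nat.le_zero.1 h))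
    exact this ▸ hA
  · intro h
    exact ⟨E, h, by simp⟩

theorem exists_of_mem_hammingThickening_succ {k : ℕ} {S : Finset (Finset β)} {E : Finset β}
    (hE : E ∈ hammingThickening (k + 1) S) :
    E ∈ hammingThickening k S ∨ ∃ e, symmDiff E {e} ∈ hammingThickening k S := by
  simp only [mem_hammingThickening] at hE ⊢
  obtain ⟨A, hA, hcard⟩ := hE
  rcases Nat.lt_or_ge k (symmDiff E A).card with h | h
  · obtain ⟨e, he⟩ := Finset.card_pos.1 (Nat.zero_lt_of_lt h)
    refine Or.inr ⟨e, A, hA, ?_⟩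
    have hsub : symmDiff (symmDiff E {e}) A = (symmDiff E A).erase e := by
      ext x
      by_cases hx : x = e
      · subst hx
        simp only [Finset.mem_symmDiff, Finset.mem_singleton, Finset.mem_erase] at he ⊢
        tauto
      · simp [Finset.mem_symmDiff, hx]
    rw [hsub, Finset.card_erase_of_mem he]
    omega
  · exact Or.inl ⟨A, hA, h⟩

/-- A union bound, one layer at a time: a set in the next layer is in the current one or becomes so
after flipping some `e`, at cost `K`. -/
theorem sum_bernoulliWeight_hammingThickening_le {p K : ℝ} (h0 : 0 ≤ p) (h1 : p ≤ 1)
    (hK : 0 ≤ K) (hK1 : p ≤ K * (1 - p)) (hK2 : 1 - p ≤ K * p) (S : Finset (Finset β)) (k : ℕ) :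
    ∑ E ∈ hammingThickening k S, bernoulliWeight p E ≤
      (1 + Fintype.card β * K) ^ k * ∑ E ∈ S, bernoulliWeight p E := by
  induction k with
  | zero => simp [hammingThickening_zero]
  | succ k ih =>
    set T := hammingThickening k S
    have hw := bernoulliWeight_nonneg (β := β) h0 h1
    have hpoint : ∀ E, (if E ∈ hammingThickening (k + 1) S then bernoulliWeight p E else 0) ≤
        (if E ∈ T then bernoulliWeight p E else 0) +
          ∑ e, K * if symmDiff E {e} ∈ T then bernoulliWeight p (symmDiff E {e}) else 0 := by
      intro E
      have hnn : ∀ e ∈ Finset.univ, 0 ≤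
          K * if symmDiff E {e} ∈ T then bernoulliWeight p (symmDiff E {e}) else 0 := by
        intro e _
        refine mul_nonneg hK ?_
        split_ifs
        exacts [hw _, le_rfl]
      have hnn' := Finset.sum_nonneg hnn
      by_cases hE : E ∈ hammingThickening (k + 1) S
      · rw [if_pos hE]
        rcases exists_of_mem_hammingThickening_succ hE with h | ⟨e, he⟩
        · rw [if_pos h]
          linarith
        · have hle := Finset.single_le_sum hnn (Finset.mem_univ e)
          rw [if_pos he] at hle
          have := bernoulliWeight_le_symmDiff_singleton h0 h1 hK1 hK2 E e
          have : 0 ≤ if E ∈ T then bernoulliWeight p E else 0 := by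
            split_ifs
            exacts [hw _, le_rfl]
          linarith
      · rw [if_neg hE]
        refine add_nonneg ?_ hnn'
        split_ifs
        exacts [hw _, le_rfl]
    have hsum := Finset.sum_le_sum fun E (_ : E ∈ (Finset.univ : Finset (Finset β))) => hpoint E
    rw [Finset.sum_add_distrib, Finset.sum_comm] at hsum
    have hflip : ∀ e : β, ∑ E : Finset β,
        K * (if symmDiff E {e} ∈ T then bernoulliWeight p (symmDiff E {e}) else 0) =
          K * ∑ E ∈ T, bernoulliWeight p E := by
      intro e
      -- Flipping `e` is an involution on all sets, so the sum can be reindexed.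
      rw [← Finset.mul_sum]
      have := Equiv.sum_comp (symmDiff_left_involutive ({e} : Finset β)).toPerm
        fun E => if E ∈ T then bernoulliWeight p E else 0
      simp only [Function.Involutive.coe_toPerm] at this
      refine congrArg (K * ·) (Eq.trans ?_ (this.trans (by simp)))
      congr!
    rw [Finset.sum_congr rfl fun e _ => hflip e] at hsum
    simp only [Finset.sum_ite_mem, Finset.univ_inter, Finset.sum_const, Finset.card_univ,
      nsmul_eq_mul] at hsum
    calc _ ≤ (1 + Fintype.card β * K) * ∑ E ∈ T, bernoulliWeight p E := by linarith
      _ ≤ (1 + Fintype.card β * K) *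
          ((1 + Fintype.card β * K) ^ k * ∑ E ∈ S, bernoulliWeight p E) :=
        mul_le_mul_of_nonneg_left ih (by positivity)
      _ = _ := by ring

end Weights

/-! ### Law of the edge set and second moment of the degrees. -/

section Probability

variable {Ω : Type*} {n : ℕ}

/-- The positions of the entries equal to `1`. -/
noncomputable def edgeSet (A : Matrix (Fin n) (Fin n) ℝ) : Finset (Fin n × Fin n) :=
  open Classical in Finset.univ.filter fun e => A e.1 e.2 = 1

theorem mem_edgeSet {A : Matrix (Fin n) (Fin n) ℝ} {e : Fin n × Fin n} :
    e ∈ edgeSet A ↔ A e.1 e.2 = 1 := by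
  simp [edgeSet]

theorem fiberCard_edgeSet {γ : Type*} [DecidableEq γ] (f : Fin n × Fin n → γ)
    {A : Matrix (Fin n) (Fin n) ℝ} (hA : ∀ i j, A i j = 0 ∨ A i j = 1) (i : γ) :
    (fiberCard f (edgeSet A) i : ℝ) = ∑ e with f e = i, A e.1 e.2 := by
  classical
  have h : ∀ e : Fin n × Fin n, A e.1 e.2 = if e ∈ edgeSet A then 1 else 0 := by
    intro e
    rcases hA e.1 e.2 with h | h <;> simp [mem_edgeSet, h]
  rw [Finset.sum_congr rfl fun e _ => h e, Finset.sum_boole, fiberCard]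
  congr 2
  ext e
  simp [and_comm]

theorem sum_filter_fst_eq (g : Fin n × Fin n → ℝ) (i : Fin n) :
    ∑ e with e.1 = i, g e = ∑ j, g (i, j) := by
  rw [Finset.sum_filter, Fintype.sum_prod_type, Finset.sum_eq_single i]
  · simp
  · intro b _ hb
    simp [hb]
  · simp

theorem sum_filter_snd_eq (g : Fin n × Fin n → ℝ) (j : Fin n) :
    ∑ e with e.2 = j, g e = ∑ i, g (i, j) := by
  rw [Finset.sum_filter, Fintype.sum_prod_type]
  simp

theorem mem_regularDigraphMatrices_iff {d : ℕ} {A : Matrix (Fin n) (Fin n) ℝ}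
    (hA : ∀ i j, A i j = 0 ∨ A i j = 1) :
    A ∈ regularDigraphMatrices n d ↔ IsBiregular d (edgeSet A) := by
  have h1 : ∀ i, (fiberCard Prod.fst (edgeSet A) i : ℝ) = (A *ᵥ fun _ => 1) i := by
    intro i
    rw [fiberCard_edgeSet _ hA, sum_filter_fst_eq]
    simp [Matrix.mulVec, dotProduct]
  have h2 : ∀ j, (fiberCard Prod.snd (edgeSet A) j : ℝ) = (Aᵀ *ᵥ fun _ => 1) j := by
    intro j
    rw [fiberCard_edgeSet _ hA, sum_filter_snd_eq]
    simp [Matrix.mulVec, dotProduct]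
  unfold IsBiregular regularDigraphMatrices
  constructor
  · rintro ⟨-, hr, hc⟩
    refine ⟨fun i => ?_, fun j => ?_⟩
    · have := h1 i
      rw [hr] at this
      exact Nat.cast_injective this
    · have := h2 j
      rw [hc] at this
      exact Nat.cast_injective this
  · rintro ⟨hr, hc⟩
    refine ⟨hA, funext fun i => ?_, funext fun j => ?_⟩
    · rw [← h1, hr]
    · rw [← h2, hc]

variable [MeasurableSpace Ω] {P : Measure Ω} [IsProbabilityMeasure P]
  {B : Ω → Matrix (Fin n) (Fin n) ℝ} {p : ℝ}

namespace IsIIDBernoulliMatrix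

omit [IsProbabilityMeasure P] in
theorem measurableSet_entry_eq_one (hB : IsIIDBernoulliMatrix P B p) (i j : Fin n) :
    MeasurableSet {ω | B ω i j = 1} :=
  hB.measurable_entry i j (measurableSet_singleton 1)

theorem prob_entry_eq_zero (hB : IsIIDBernoulliMatrix P B p) (i j : Fin n) :
    P.real {ω | B ω i j = 0} = 1 - p := by
  have h : {ω | B ω i j = 0} = {ω | B ω i j = 1}ᶜ := by
    ext ω
    rcases hB.entry_eq ω i j with h | h <;> simp [h]
  rw [h, probReal_compl_eq_one_sub (hB.measurableSet_entry_eq_one i j), hB.prob_entry_eq_one]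

omit [MeasurableSpace Ω] in
theorem edgeSet_preimage_eq (hB : ∀ ω i j, B ω i j = 0 ∨ B ω i j = 1)
    (E : Finset (Fin n × Fin n)) :
    (fun ω => edgeSet (B ω)) ⁻¹' {E} =
      ⋂ e : Fin n × Fin n, (fun ω => B ω e.1 e.2) ⁻¹' {if e ∈ E then 1 else 0} := by
  ext ω
  simp only [Set.mem_preimage, Set.mem_singleton_iff, Set.mem_iInter, Finset.ext_iff, mem_edgeSet]
  refine forall_congr' fun e => ?_
  rcases hB ω e.1 e.2 with h | h <;> by_cases he : e ∈ E <;> simp [h, he]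

omit [IsProbabilityMeasure P] in
theorem measurableSet_edgeSet_preimage (hB : IsIIDBernoulliMatrix P B p)
    (E : Finset (Fin n × Fin n)) : MeasurableSet ((fun ω => edgeSet (B ω)) ⁻¹' {E}) := by
  rw [edgeSet_preimage_eq hB.entry_eq]
  exact MeasurableSet.iInter fun e => hB.measurable_entry e.1 e.2 (measurableSet_singleton _)

theorem prob_edgeSet_eq (hB : IsIIDBernoulliMatrix P B p) (E : Finset (Fin n × Fin n)) :
    P.real ((fun ω => edgeSet (B ω)) ⁻¹' {E}) = bernoulliWeight p E := by
  rw [edgeSet_preimage_eq hB.entry_eq, measureReal_def,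
    hB.indep.meas_iInter fun e => ⟨_, measurableSet_singleton _, rfl⟩, ENNReal.toReal_prod]
  refine Finset.prod_congr rfl fun e _ => ?_
  split_ifs
  · exact hB.prob_entry_eq_one e.1 e.2
  · exact hB.prob_entry_eq_zero e.1 e.2

theorem prob_edgeSet_mem (hB : IsIIDBernoulliMatrix P B p)
    (S : Finset (Finset (Fin n × Fin n))) :
    P.real {ω | edgeSet (B ω) ∈ S} = ∑ E ∈ S, bernoulliWeight p E := by
  rw [← Finset.sum_congr rfl fun E _ => hB.prob_edgeSet_eq E,
    sum_measureReal_preimage_singleton S fun E _ => hB.measurableSet_edgeSet_preimage E]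
  rfl

theorem memLp_entry (hB : IsIIDBernoulliMatrix P B p) (i j : Fin n) :
    MemLp (fun ω => B ω i j) 2 P := by
  refine MemLp.of_bound (hB.measurable_entry i j).aestronglyMeasurable 1 (ae_of_all _ fun ω => ?_)
  rcases hB.entry_eq ω i j with h | h <;> simp [h]

omit [IsProbabilityMeasure P] in
theorem integral_entry (hB : IsIIDBernoulliMatrix P B p) (i j : Fin n) :
    ∫ ω, B ω i j ∂P = p := by
  have h : (fun ω => B ω i j) = {ω | B ω i j = 1}.indicator 1 := by
    ext ω
    rcases hB.entry_eq ω i j with h | h <;> simp [h]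
  rw [h, integral_indicator_one (hB.measurableSet_entry_eq_one i j), hB.prob_entry_eq_one]

theorem variance_entry_le (hB : IsIIDBernoulliMatrix P B p) (i j : Fin n) :
    variance (fun ω => B ω i j) P ≤ p := by
  refine (variance_le_expectation_sq (hB.measurable_entry i j).aestronglyMeasurable).trans_eq ?_
  rw [← hB.integral_entry i j]
  congr 1
  ext ω
  rcases hB.entry_eq ω i j with h | h <;> simp [h]

theorem integrable_sum_entry_sub_sq (hB : IsIIDBernoulliMatrix P B p)
    (s : Finset (Fin n × Fin n)) (c : ℝ) :
    Integrable (fun ω => (∑ e ∈ s, B ω e.1 e.2 - c) ^ 2) P :=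
  ((memLp_finsetSum s fun e _ => hB.memLp_entry e.1 e.2).sub (memLp_const c)).integrable_sq

theorem integral_sum_entry_sub_sq_le (hB : IsIIDBernoulliMatrix P B p)
    (s : Finset (Fin n × Fin n)) :
    ∫ ω, (∑ e ∈ s, B ω e.1 e.2 - s.card * p) ^ 2 ∂P ≤ s.card * p := by
  have hmean : ∫ ω, (∑ e ∈ s, fun ω => B ω e.1 e.2) ω ∂P = s.card * p := by
    simp only [Finset.sum_apply]
    rw [integral_finsetSum s fun e _ => (hB.memLp_entry e.1 e.2).integrable one_le_two,
      Finset.sum_congr rfl fun e _ => hB.integral_entry e.1 e.2]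
    simp
  have hvar := IndepFun.variance_sum (s := s) (fun e _ => hB.memLp_entry e.1 e.2)
    fun e _ e' _ hne => hB.indep.indepFun hne
  rw [variance_eq_integral, hmean] at hvar
  · simp only [Finset.sum_apply] at hvar
    rw [hvar]
    refine (Finset.sum_le_sum fun e _ => hB.variance_entry_le e.1 e.2).trans ?_
    simp
  · exact (memLp_finsetSum' s fun e _ => hB.memLp_entry e.1 e.2).aestronglyMeasurable.aemeasurable

end IsIIDBernoulliMatrix

/-- Sum of the squared deviations of the degrees from `d`. -/
noncomputable def squaredDegreeDeviation (d : ℕ) (E : Finset (Fin n × Fin n)) : ℝ :=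
  ∑ i, ((fiberCard Prod.fst E i : ℝ) - d) ^ 2 + ∑ j, ((fiberCard Prod.snd E j : ℝ) - d) ^ 2

/-- Termwise `2 s |x| ≤ x ^ 2 + s ^ 2`, over `2 n` degrees; applied with `s = √d`, the typical size
of a deviation. -/
theorem degreeDeviation_mul_le (d : ℕ) (E : Finset (Fin n × Fin n)) {s : ℝ} :
    2 * s * degreeDeviation d E ≤ squaredDegreeDeviation d E + 2 * n * s ^ 2 := by
  have key : ∀ f : Fin n × Fin n → Fin n, 2 * s * ∑ i, |(fiberCard f E i : ℝ) - d| ≤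
      ∑ i, ((fiberCard f E i : ℝ) - d) ^ 2 + n * s ^ 2 := by
    intro f
    have : (n : ℝ) * s ^ 2 = ∑ _i : Fin n, s ^ 2 := by simp
    rw [this, ← Finset.sum_add_distrib, Finset.mul_sum]
    refine Finset.sum_le_sum fun i _ => ?_
    rw [← sq_abs ((fiberCard f E i : ℝ) - d)]
    nlinarith [sq_nonneg (|(fiberCard f E i : ℝ) - d| - s)]
  have h1 := key Prod.fst
  have h2 := key Prod.snd
  unfold degreeDeviation squaredDegreeDeviation
  linarith

namespace IsIIDBernoulliMatrix

theorem integrable_and_integral_squaredDegreeDeviation_le {d : ℕ} (hn : n ≠ 0)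
    (hB : IsIIDBernoulliMatrix P B ((d : ℝ) / n)) :
    Integrable (fun ω => squaredDegreeDeviation d (edgeSet (B ω))) P ∧
      ∫ ω, squaredDegreeDeviation d (edgeSet (B ω)) ∂P ≤ 2 * n * d := by
  have hcard1 : ∀ i : Fin n, (Finset.univ.filter fun e : Fin n × Fin n => e.1 = i).card = n := by
    intro i
    have := sum_filter_fst_eq (fun _ => 1) i
    simp only [Finset.sum_const, nsmul_eq_mul, mul_one, Finset.card_univ, Fintype.card_fin] at this
    exact_mod_cast this
  have hcard2 : ∀ i : Fin n, (Finset.univ.filter fun e : Fin n × Fin n => e.2 = i).card = n := by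
    intro i
    have := sum_filter_snd_eq (fun _ => 1) i
    simp only [Finset.sum_const, nsmul_eq_mul, mul_one, Finset.card_univ, Fintype.card_fin] at this
    exact_mod_cast this
  have hnp : (n : ℝ) * (d / n) = d := by
    have : (n : ℝ) ≠ 0 := by exact_mod_cast hn
    field_simp
  have key : ∀ f : Fin n × Fin n → Fin n,
      (∀ i, (Finset.univ.filter fun e : Fin n × Fin n => f e = i).card = n) →
      (∀ i, Integrable (fun ω => ((fiberCard f (edgeSet (B ω)) i : ℝ) - d) ^ 2) P) ∧
      ∀ i, ∫ ω, ((fiberCard f (edgeSet (B ω)) i : ℝ) - d) ^ 2 ∂P ≤ d := by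
    intro f hf
    refine ⟨fun i => ?_, fun i => ?_⟩
    · simp only [fiberCard_edgeSet f (hB.entry_eq _)]
      exact hB.integrable_sum_entry_sub_sq _ _
    · have := hB.integral_sum_entry_sub_sq_le (Finset.univ.filter fun e => f e = i)
      rw [hf, hnp] at this
      simpa only [fiberCard_edgeSet f (hB.entry_eq _)] using this
  obtain ⟨hi1, hb1⟩ := key Prod.fst hcard1
  obtain ⟨hi2, hb2⟩ := key Prod.snd hcard2
  have hI1 := integrable_finsetSum Finset.univ fun i _ => hi1 i
  have hI2 := integrable_finsetSum Finset.univ fun i _ => hi2 i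
  refine ⟨hI1.add hI2, ?_⟩
  unfold squaredDegreeDeviation
  rw [integral_add hI1 hI2, integral_finsetSum _ fun i _ => hi1 i,
    integral_finsetSum _ fun i _ => hi2 i]
  have h1 := Finset.sum_le_sum fun i (_ : i ∈ Finset.univ) => hb1 i
  have h2 := Finset.sum_le_sum fun i (_ : i ∈ Finset.univ) => hb2 i
  simp only [Finset.sum_const, Finset.card_univ, Fintype.card_fin, nsmul_eq_mul] at h1 h2
  linarith

theorem half_le_prob_degreeDeviation_le {d : ℕ} (hn : n ≠ 0) (hd : d ≠ 0)
    (hB : IsIIDBernoulliMatrix P B ((d : ℝ) / n)) :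
    1 / 2 ≤ P.real {ω | degreeDeviation d (edgeSet (B ω)) ≤ 3 * (n * Real.sqrt d)} := by
  obtain ⟨hint, hle⟩ := integrable_and_integral_squaredDegreeDeviation_le hn hB
  have hn0 : (0 : ℝ) < n := by exact_mod_cast Nat.pos_of_ne_zero hn
  have hd0 : (0 : ℝ) < d := by exact_mod_cast Nat.pos_of_ne_zero hd
  -- The threshold is twice the bound `2 n d` on the mean, so the bad event has probability at most
  -- 1/2.
  have hmarkov := mul_meas_ge_le_integral_of_nonneg (ae_of_all P fun ω => by
    change 0 ≤ squaredDegreeDeviation d (edgeSet (B ω))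
    unfold squaredDegreeDeviation
    positivity) hint (4 * n * d)
  have hbad : P.real {ω | 4 * n * d ≤ squaredDegreeDeviation d (edgeSet (B ω))} ≤ 1 / 2 := by
    have : (0 : ℝ) < n * d := by positivity
    by_contra! hcon
    nlinarith
  have hcover : (Set.univ : Set Ω) ⊆
      {ω | degreeDeviation d (edgeSet (B ω)) ≤ 3 * (n * Real.sqrt d)} ∪
        {ω | 4 * n * d ≤ squaredDegreeDeviation d (edgeSet (B ω))} := by
    intro ω _
    by_cases h : 4 * n * d ≤ squaredDegreeDeviation d (edgeSet (B ω))
    · exact Or.inr h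
    · refine Or.inl ?_
      have hs := Real.sq_sqrt hd0.le
      have hs0 := Real.sqrt_pos.2 hd0
      have := degreeDeviation_mul_le d (edgeSet (B ω)) (s := Real.sqrt d)
      rw [hs] at this
      change degreeDeviation d (edgeSet (B ω)) ≤ _
      refine le_of_mul_le_mul_left ?_ (mul_pos two_pos hs0)
      push Not at h
      calc _ ≤ 6 * n * (d : ℝ) := by linarith
        _ = 6 * n * Real.sqrt d ^ 2 := by rw [hs]
        _ = _ := by ring
  have h1 := (measureReal_mono (μ := P) hcover (by finiteness)).trans (measureReal_union_le _ _)
  rw [probReal_univ] at h1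
  linarith

/-- Here `21 = 7 * 3`: the repair cost times the typical deviation. -/
theorem half_le_pow_mul_prob_regular {d M : ℕ} (hd0 : d ≠ 0) (hdn : 2 * d ≤ n)
    (hB : IsIIDBernoulliMatrix P B ((d : ℝ) / n)) (hM : 21 * (n * Real.sqrt d) ≤ M) :
    1 / 2 ≤ (1 + (n : ℝ) ^ 3) ^ M * P.real {ω | B ω ∈ regularDigraphMatrices n d} := by
  classical
  have hn : n ≠ 0 := by omega
  have hn0 : (0 : ℝ) < n := by exact_mod_cast Nat.pos_of_ne_zero hn
  have hd1 : (1 : ℝ) ≤ d := by exact_mod_cast Nat.pos_of_ne_zero hd0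
  have hdn' : 2 * (d : ℝ) ≤ n := by exact_mod_cast hdn
  set S : Finset (Finset (Fin n × Fin n)) := Finset.univ.filter fun E => IsBiregular d E
  have hreg : {ω | B ω ∈ regularDigraphMatrices n d} = {ω | edgeSet (B ω) ∈ S} := by
    ext ω
    simp [S, mem_regularDigraphMatrices_iff (hB.entry_eq ω)]
  have hsub : {ω | degreeDeviation d (edgeSet (B ω)) ≤ 3 * (n * Real.sqrt d)} ⊆
      {ω | edgeSet (B ω) ∈ hammingThickening M S} := by
    intro ω hω
    obtain ⟨A, hA, hdist⟩ := exists_isBiregular_card_symmDiff_le hdn (edgeSet (B ω))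
    refine mem_hammingThickening.2 ⟨A, by simp [S, hA], ?_⟩
    have hω' : degreeDeviation d (edgeSet (B ω)) ≤ 3 * (n * Real.sqrt d) := hω
    have : ((symmDiff (edgeSet (B ω)) A).card : ℝ) ≤ M := by linarith
    exact_mod_cast this
  have hp0 : 0 ≤ (d : ℝ) / n := by positivity
  have hp2 : (d : ℝ) / n ≤ 1 / 2 := by
    rw [div_le_iff₀ hn0]
    linarith
  have hnp : (n : ℝ) * (d / n) = d := by field_simp
  -- `K = n` is admissible: `p ≤ 1/2` gives `p ≤ n (1 - p)`, and `n p = d ≥ 1` gives `1 - p ≤ n p`.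
  have hw := sum_bernoulliWeight_hammingThickening_le (K := n) hp0 (by linarith) hn0.le
    (by nlinarith) (by rw [hnp]; linarith) S M
  have h1 := (half_le_prob_degreeDeviation_le hn hd0 hB).trans
    (measureReal_mono hsub (by finiteness))
  rw [hB.prob_edgeSet_mem] at h1
  rw [hreg, hB.prob_edgeSet_mem]
  refine h1.trans (hw.trans_eq ?_)
  simp only [Fintype.card_prod, Fintype.card_fin]
  push_cast
  ring

end IsIIDBernoulliMatrix

end Probability

/-! ### Choice of constants and conclusion. -/

theorem lemmaB1 :
    ∃ C : ℝ, 0 < C ∧ ∀ ε : ℝ, 0 < ε → ∃ N : ℕ, ∀ α : ℝ, 0 < α → α < 1 / 2 →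
      ∀ n d : ℕ, N ≤ n →
        (Real.log (n : ℝ)) ^ (1 / (1 - 2 * α) + ε) ≤ (d : ℝ) → (d : ℝ) ≤ (n : ℝ) / 2 →
        ∀ {Ω : Type*} [MeasurableSpace Ω] (P : Measure Ω) [IsProbabilityMeasure P]
          (B : Ω → Matrix (Fin n) (Fin n) ℝ),
          IsIIDBernoulliMatrix P B ((d : ℝ) / (n : ℝ)) →
          Real.exp (-(C * (n : ℝ) * Real.log (n : ℝ) *
              max (Real.sqrt ((d : ℝ) * Real.log (n : ℝ)))
                (max ((d : ℝ) ^ (2 / 3 : ℝ)) ((d : ℝ) ^ (1 - α)))))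
            ≤ P.real {ω | B ω ∈ regularDigraphMatrices n d} := by
  -- `n ≥ 3` secures `log n ≥ 1`, `1 + n ^ 3 ≤ n ^ 4` and `1 / n ≤ 1 / 2`. The constant 100 covers
  -- `4 * 21 = 84` plus the rounding term 5, since `n √d ≥ 3`.
  refine ⟨100, by norm_num, fun ε _ => ⟨3, fun α _ _ n d hn hlog hd Ω _ P _ B hB => ?_⟩⟩
  have hn3 : (3 : ℝ) ≤ n := by exact_mod_cast hn
  have hlog1 : 1 ≤ Real.log n := by
    rw [Real.le_log_iff_exp_le (by linarith)]
    linarith [Real.exp_one_lt_d9]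
  have hd0 : d ≠ 0 := by
    rintro rfl
    have := Real.rpow_pos_of_pos (zero_lt_one.trans_le hlog1) (1 / (1 - 2 * α) + ε)
    simp only [Nat.cast_zero] at hlog
    linarith
  have hd1 : (1 : ℝ) ≤ d := by exact_mod_cast Nat.pos_of_ne_zero hd0
  have hdn : 2 * d ≤ n := by
    have : 2 * (d : ℝ) ≤ n := by linarith
    exact_mod_cast this
  set M := ⌈21 * (n * Real.sqrt d)⌉₊
  have hs1 : 1 ≤ Real.sqrt d := Real.one_le_sqrt.2 hd1
  have hns : 3 ≤ n * Real.sqrt d := by nlinarith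
  have hM : (M : ℝ) < 21 * (n * Real.sqrt d) + 1 := Nat.ceil_lt_add_one (by positivity)
  have key := hB.half_le_pow_mul_prob_regular hd0 hdn (Nat.le_ceil _ : _ ≤ (M : ℝ))
  have hbase : 1 + (n : ℝ) ^ 3 ≤ Real.exp (4 * Real.log n) := by
    have : Real.exp (4 * Real.log n) = (n : ℝ) ^ 4 := by
      rw [mul_comm, Real.exp_mul, Real.exp_log (by linarith)]
      norm_cast
    rw [this]
    nlinarith [pow_pos (zero_lt_three.trans_le hn3) 3, one_le_pow₀ (n := 3)
      (by linarith : (1 : ℝ) ≤ n)]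
  have hhalf : Real.exp (-Real.log n) ≤ 1 / 2 := by
    rw [Real.exp_neg, Real.exp_log (by linarith), inv_eq_one_div]
    exact one_div_le_one_div_of_le two_pos (by linarith)
  set R := P.real {ω | B ω ∈ regularDigraphMatrices n d}
  have hmain : Real.exp (-Real.log n) ≤ Real.exp (4 * Real.log n * M) * R := by
    refine (hhalf.trans key).trans (mul_le_mul_of_nonneg_right ?_ measureReal_nonneg)
    rw [mul_comm _ (M : ℝ), Real.exp_nat_mul]
    exact pow_le_pow_left₀ (by positivity) hbase M
  have hR : Real.exp (-(4 * Real.log n * M + Real.log n)) ≤ R := by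
    have := mul_le_mul_of_nonneg_left hmain (Real.exp_pos (-(4 * Real.log n * M))).le
    rw [← mul_assoc, ← Real.exp_add, ← Real.exp_add, neg_add_cancel, Real.exp_zero, one_mul] at this
    rwa [neg_add]
  refine le_trans (Real.exp_le_exp.2 (neg_le_neg ?_)) hR
  have hmax : Real.sqrt d ≤ max (Real.sqrt ((d : ℝ) * Real.log (n : ℝ)))
      (max ((d : ℝ) ^ (2 / 3 : ℝ)) ((d : ℝ) ^ (1 - α))) :=
    (Real.sqrt_le_sqrt (by nlinarith)).trans (le_max_left _ _)
  calc 4 * Real.log n * M + Real.log n = Real.log n * (4 * M + 1) := by ring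
    _ ≤ Real.log n * (100 * (n * Real.sqrt d)) :=
      mul_le_mul_of_nonneg_left (by linarith) (by linarith)
    _ = 100 * n * Real.log n * Real.sqrt d := by ring
    _ ≤ _ := mul_le_mul_of_nonneg_left hmax (by positivity)
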